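/- For an integer $n\ge 0$ write $[0,n]=\{0,1,\dots,n\}$. For $S\subseteq[0,n]$ let $S\pm S=\{s_1\pm s_2: s_1,s_2\in S\}$ and \[ \lambda_n(S)=\bigl(2n+1-|S+S|,\ 2n+1-|S-S|\bigr), \] the pair consisting of the numbers of missing sums and of missing differences. For each $n$ let $S_n$ be a uniformly random subset of $[0,n]$. (1) Let $\Lambda\subseteq\mathbb{Z}_{\ge0}\times\mathbb{Z}_{\ge0}$ contain at least one element $(s,d)$ with $d$ even. Let $(\alpha_n)$ be a sequence of integers with $\alpha_n\to\infty$ and with $0<\alpha_n<n/2$ for all sufficiently large $n$, and let $(k_n)$ be a sequence of integers with $\alpha_n<k_n<n-\alpha_n$ for all sufficiently large $n$. Then \[ \lim_{n\to\infty}\mathbb{P}\bigl(k_n\in S_n \,\big|\, \lambda_n(S_n)\in\Lambda\bigr)=\frac12 . \] (2) (The Miller--Orosz--Scheinerman conjecture.) Call $S$ an MSTD set if $|S+S|>|S-S|$. Let $0<c<1/2$, and let $(k_n)$ be a sequence of integers with $cn<k_n<n-cn$ for all sufficiently large $n$. Then \[ \lim_{n\to\infty}\frac{\bigl|\{S\subseteq[0,n]: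 k_n\in S\text{ and } S\text{ is MSTD}\}\bigr|}{\bigl|\{S\subseteq[0,n]: S\text{ is MSTD}\}\bigr|}=\frac12 . \] -/

import Mathlib

open Filter Topology MeasureTheory ProbabilityTheory
open scoped Pointwise

/-- The interval `[0, n] = {0, 1, …, n}` of integers. -/
noncomputable def interval (n : ℕ) : Finset ℤ := Finset.Icc 0 (n : ℤ)

/-- Every collection of finite sets of integers is an event. -/
instance finsetIntMeasurableSpace : MeasurableSpace (Finset ℤ) := ⊤

/-- The law of a uniform random subset of `[0, n]`. -/
noncomputable def uniformSubset (n : ℕ) : Measure (Finset ℤ) :=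
  uniformOn ((interval n).powerset : Set (Finset ℤ))

/-- `λ_n(S)`: the number of missing sums and the number of missing differences of `S ⊆ [0, n]`.
The subtractions do not truncate, since `S + S ⊆ [0, 2n]` and `S - S ⊆ [-n, n]`. -/
def missing (n : ℕ) (S : Finset ℤ) : ℕ × ℕ :=
  (2 * n + 1 - (S + S).card, 2 * n + 1 - (S - S).card)

/-- More sums than differences. -/
def IsMSTD (S : Finset ℤ) : Prop := (S - S).card < (S + S).card

instance IsMSTD.decidablePred : DecidablePred IsMSTD :=
  fun S => inferInstanceAs (Decidable ((S - S).card < (S + S).card))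

/-- The proportion, among the MSTD subsets of `[0, n]`, of those that contain `k`. -/
noncomputable def mstdProportion (n : ℕ) (k : ℤ) : ℝ :=
  (((interval n).powerset.filter (fun S => k ∈ S ∧ IsMSTD S)).card : ℝ) /
    (((interval n).powerset.filter (fun S => IsMSTD S)).card : ℝ)

/-! For a random S, a sum or difference is unlikely to be missing unless it lies near an end of its
range: t, 2n - t and n - t each have at least about t/2 disjoint pairs that could represent them, so
each is missing with probability O((9/10)^t), even after k has been removed from S. Hence, outside
an event of probability at most 60 (9/10)^a, every sum and difference at distance at least a from
the ends is present without the help of k (`card_filter_not_middleFull_le`). If a < k < n - a, every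
sum or difference that uses k lies in this range, so toggling k leaves `missing` unchanged. Toggling
pairs the sets containing k with those that do not, up to that small error
(`abs_two_mul_card_sub_card_le`).

This decides the conditional probability only if the condition itself has probability bounded below.
That is `exists_le_card_missing_eq`: for every (s, 2d), fixed fringes at both ends of [0, n]
prescribe exactly s missing sums and 2d missing differences, while the middle stays essentially
free. With a = α_n → ∞ the error is then negligible. The MSTD statement is the case Λ = {s < d},
which contains (0, 2). -/

/-! ### Fringes with prescribed missing sums and differences -/

/-- The lower fringe: all odd numbers below `30 M` outside two blocks, together with `0` and
`10 M`. -/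
noncomputable def lowFringe (M s d : ℕ) : Finset ℤ :=
  (Finset.Ico (0 : ℤ) (30 * M + 2 * d)).filter fun x =>
    x = 0 ∨ x = 10 * M ∨
      (x % 2 = 1 ∧ x < 30 * M ∧ ¬ (4 * M + 2 ≤ x ∧ x ≤ 4 * M + 2 * s + 1) ∧
        ¬ (18 * M ≤ x ∧ x < 18 * M + 2 * d))

/-- The (reflected) upper fringe: all odd numbers below `30 M` outside a block, together with `0`
and `12 M`. -/
noncomputable def highFringe (M d : ℕ) : Finset ℤ :=
  (Finset.Ico (0 : ℤ) (30 * M + 2 * d)).filter fun x =>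
    x = 0 ∨ x = 12 * M ∨ (x % 2 = 1 ∧ x < 30 * M ∧ ¬ (20 * M ≤ x ∧ x < 20 * M + 2 * d))

theorem mem_lowFringe {M s d : ℕ} {x : ℤ} : x ∈ lowFringe M s d ↔
    (0 ≤ x ∧ x < 30 * M + 2 * d) ∧ (x = 0 ∨ x = 10 * M ∨
      (x % 2 = 1 ∧ x < 30 * M ∧ ¬ (4 * M + 2 ≤ x ∧ x ≤ 4 * M + 2 * s + 1) ∧
        ¬ (18 * M ≤ x ∧ x < 18 * M + 2 * d))) := by
  simp only [lowFringe, Finset.mem_filter, Finset.mem_Ico]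

theorem mem_highFringe {M d : ℕ} {x : ℤ} : x ∈ highFringe M d ↔
    (0 ≤ x ∧ x < 30 * M + 2 * d) ∧ (x = 0 ∨ x = 12 * M ∨
      (x % 2 = 1 ∧ x < 30 * M ∧ ¬ (20 * M ≤ x ∧ x < 20 * M + 2 * d))) := by
  simp only [highFringe, Finset.mem_filter, Finset.mem_Ico]

/-- Every positive even number in the fringe range is a sum of two odd numbers which lie in both
fringes. -/
theorem exists_odd_decomposition {M s d : ℕ} (hs : s < M) (hd : d < M) {x : ℤ} (h0 : 0 < x)
    (hx : x < 30 * M + 2 * d) (he : x % 2 = 0) :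
    ∃ u v, u + v = x ∧ u ∈ lowFringe M s d ∧ v ∈ lowFringe M s d ∧
      u ∈ highFringe M d ∧ v ∈ highFringe M d := by
  -- Summands below 18M avoid the blocks at 18M and 20M, so only the block after 4M + 1 has to be
  -- dodged. The anchors 1, 4M + 1 and 14M + 1 together do this for all even x up to 32M.
  have key : ∀ u v : ℤ, u + v = x → 0 < u → 0 < v → u % 2 = 1 → u < 18 * M → v < 18 * M →
      ¬ (4 * M + 2 ≤ u ∧ u ≤ 4 * M + 2 * s + 1) → ¬ (4 * M + 2 ≤ v ∧ v ≤ 4 * M + 2 * s + 1) →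
      ∃ u v, u + v = x ∧ u ∈ lowFringe M s d ∧ v ∈ lowFringe M s d ∧
        u ∈ highFringe M d ∧ v ∈ highFringe M d := by
    intro u v h hu hv hu2 hu3 hv3 hu4 hv4
    refine ⟨u, v, h, ?_, ?_, ?_, ?_⟩ <;> simp only [mem_lowFringe, mem_highFringe]
    · exact ⟨⟨by omega, by omega⟩, .inr (.inr ⟨hu2, by omega, hu4, by omega⟩)⟩
    · exact ⟨⟨by omega, by omega⟩, .inr (.inr ⟨by omega, by omega, hv4, by omega⟩)⟩
    · exact ⟨⟨by omega, by omega⟩, .inr (.inr ⟨hu2, by omega, by omega⟩)⟩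
    · exact ⟨⟨by omega, by omega⟩, .inr (.inr ⟨by omega, by omega, by omega⟩)⟩
  rcases le_or_gt x (4 * M + 2) with h1 | h1
  · exact key 1 (x - 1) (by ring) (by omega) (by omega) (by omega) (by omega) (by omega)
      (by omega) (by omega)
  rcases le_or_gt x (8 * M + 2) with h2 | h2
  · exact key (4 * M + 1) (x - (4 * M + 1)) (by ring) (by omega) (by omega) (by omega) (by omega)
      (by omega) (by omega) (by omega)
  rcases le_or_gt x (18 * M) with h3 | h3
  · exact key 1 (x - 1) (by ring) (by omega) (by omega) (by omega) (by omega) (by omega)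
      (by omega) (by omega)
  rcases le_or_gt x (22 * M) with h4 | h4
  · exact key (4 * M + 1) (x - (4 * M + 1)) (by ring) (by omega) (by omega) (by omega) (by omega)
      (by omega) (by omega) (by omega)
  · exact key (14 * M + 1) (x - (14 * M + 1)) (by ring) (by omega) (by omega) (by omega)
      (by omega) (by omega) (by omega) (by omega)

/-- An odd sum uses one of the even elements 0 and 10M. The s odd numbers in the first block are too
small for 10M to help; the gaps at 18M and beyond 30M are filled by 10M plus an odd element. -/
theorem sdiff_low_add_low {M s d : ℕ} (hs : s < M) (hd : d < M) :
    Finset.Ico (0 : ℤ) (30 * M + 2 * d) \ (lowFringe M s d + lowFringe M s d) =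
      (Finset.range s).image fun i : ℕ => (4 * M + 3 + 2 * i : ℤ) := by
  ext x
  simp only [Finset.mem_sdiff, Finset.mem_Ico, Finset.mem_image, Finset.mem_range]
  constructor
  · rintro ⟨⟨h0, hx⟩, hn⟩
    have hn' : ∀ u v, u + v = x → u ∈ lowFringe M s d → v ∈ lowFringe M s d → False :=
      fun u v h hu hv => hn (Finset.mem_add.2 ⟨u, hu, v, hv, h⟩)
    simp only [mem_lowFringe] at hn'
    by_cases he : x % 2 = 0
    · rcases h0.eq_or_lt with h0 | h0
      · exact (hn' 0 0 (by omega) (by omega) (by omega)).elim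
      · obtain ⟨u, v, h, hu, hv, -⟩ := exists_odd_decomposition hs hd h0 hx he
        exact (hn (Finset.mem_add.2 ⟨u, hu, v, hv, h⟩)).elim
    · by_cases hR : 4 * M + 2 ≤ x ∧ x ≤ 4 * M + 2 * s + 1
      · exact ⟨((x - (4 * M + 3)) / 2).toNat, by omega, by omega⟩
      · exfalso
        by_cases h1 : x < 30 * M ∧ ¬ (18 * M ≤ x ∧ x < 18 * M + 2 * d)
        · exact hn' 0 x (by omega) (by omega) (by omega)
        · exact hn' (10 * M) (x - 10 * M) (by omega) (by omega) (by omega)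
  · rintro ⟨i, hi, rfl⟩
    refine ⟨⟨by omega, by omega⟩, fun hn => ?_⟩
    obtain ⟨u, hu, v, hv, h⟩ := Finset.mem_add.1 hn
    simp only [mem_lowFringe] at hu hv
    omega

/-- The gaps at 20M and beyond 30M are filled by 12M plus odd numbers near 8M and 18M, which the
upper fringe contains. -/
theorem sdiff_high_add_high {M s d : ℕ} (hs : s < M) (hd : d < M) :
    Finset.Ico (0 : ℤ) (30 * M + 2 * d) \ (highFringe M d + highFringe M d) = ∅ := by
  rw [Finset.sdiff_eq_empty_iff_subset]
  intro x hx
  obtain ⟨h0, hx⟩ := Finset.mem_Ico.1 hx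
  have hn : ∀ u v, u + v = x → u ∈ highFringe M d → v ∈ highFringe M d →
      x ∈ highFringe M d + highFringe M d :=
    fun u v h hu hv => Finset.mem_add.2 ⟨u, hu, v, hv, h⟩
  by_cases he : x % 2 = 0
  · rcases h0.eq_or_lt with h0 | h0
    · exact hn 0 0 (by omega) (mem_highFringe.2 (by omega)) (mem_highFringe.2 (by omega))
    · obtain ⟨u, v, h, -, -, hu, hv⟩ := exists_odd_decomposition hs hd h0 hx he
      exact hn u v h hu hv
  · by_cases h1 : x < 30 * M ∧ ¬ (20 * M ≤ x ∧ x < 20 * M + 2 * d)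
    · exact hn 0 x (by omega) (mem_highFringe.2 (by omega)) (mem_highFringe.2 (by omega))
    · exact hn (12 * M) (x - 12 * M) (by omega) (mem_highFringe.2 (by omega))
        (mem_highFringe.2 (by omega))

/-- The blocks sit at 18M = 30M - 12M and 20M = 30M - 10M so that an odd x ≥ 30M in the window fails
all four ways: x is in neither fringe, x - 12M is in the lower gap and x - 10M in the upper one.
Below 30M the two fringes cover each other's gaps. -/
theorem sdiff_low_add_high {M s d : ℕ} (hs : s < M) (hd : d < M) :
    Finset.Ico (0 : ℤ) (30 * M + 2 * d) \ (lowFringe M s d + highFringe M d) =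
      (Finset.range d).image fun i : ℕ => (30 * M + 1 + 2 * i : ℤ) := by
  ext x
  simp only [Finset.mem_sdiff, Finset.mem_Ico, Finset.mem_image, Finset.mem_range]
  constructor
  · rintro ⟨⟨h0, hx⟩, hn⟩
    have hn' : ∀ u v, u + v = x → u ∈ lowFringe M s d → v ∈ highFringe M d → False :=
      fun u v h hu hv => hn (Finset.mem_add.2 ⟨u, hu, v, hv, h⟩)
    simp only [mem_lowFringe, mem_highFringe] at hn'
    by_cases he : x % 2 = 0
    · rcases h0.eq_or_lt with h0 | h0
      · exact (hn' 0 0 (by omega) (by omega) (by omega)).elim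
      · obtain ⟨u, v, h, hu, -, -, hv⟩ := exists_odd_decomposition hs hd h0 hx he
        exact (hn (Finset.mem_add.2 ⟨u, hu, v, hv, h⟩)).elim
    · by_cases hD : 30 * M ≤ x
      · exact ⟨((x - (30 * M + 1)) / 2).toNat, by omega, by omega⟩
      · exfalso
        by_cases h1 : 20 * M ≤ x ∧ x < 20 * M + 2 * d
        · exact hn' x 0 (by omega) (by omega) (by omega)
        · exact hn' 0 x (by omega) (by omega) (by omega)
  · rintro ⟨i, hi, rfl⟩
    refine ⟨⟨by omega, by omega⟩, fun hn => ?_⟩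
    obtain ⟨u, hu, v, hv, h⟩ := Finset.mem_add.1 hn
    simp only [mem_lowFringe, mem_highFringe] at hu hv
    omega

/-- Every pair `(s, d)` is realized by a pair of fringes: `A + A` and `B + B` miss `s` numbers
altogether, and `A + B` misses `d` numbers. -/
theorem exists_fringes (s d : ℕ) : ∃ (l : ℕ) (A B : Finset ℤ),
    A ⊆ Finset.Ico 0 (l : ℤ) ∧ B ⊆ Finset.Ico 0 (l : ℤ) ∧ 0 ∈ A ∧ 0 ∈ B ∧
    (Finset.Ico 0 (l : ℤ) \ (A + A)).card + (Finset.Ico 0 (l : ℤ) \ (B + B)).card = s ∧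
    (Finset.Ico 0 (l : ℤ) \ (A + B)).card = d := by
  have hs : s < s + d + 1 := by omega
  have hd : d < s + d + 1 := by omega
  generalize s + d + 1 = M at hs hd
  refine ⟨30 * M + 2 * d, lowFringe M s d, highFringe M d, ?_⟩
  push_cast
  refine ⟨Finset.filter_subset _ _, Finset.filter_subset _ _, mem_lowFringe.2 (by omega),
    mem_highFringe.2 (by omega), ?_, ?_⟩
  · rw [sdiff_low_add_low hs hd, sdiff_high_add_high hs hd, Finset.card_image_of_injective]
    · simp
    · intro i j h
      simpa using h
  · rw [sdiff_low_add_high hs hd, Finset.card_image_of_injective]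
    · simp
    · intro i j h
      simpa using h

/-! ### Middle sums and differences are rarely missing -/

/-- A uniform random set contains none of `m` given disjoint pairs with probability at most
`(3/4) ^ m`. -/
theorem card_filter_no_pair_mul_le (f : ℤ → ℤ) (J : Finset ℤ) : ∀ I : Finset ℤ, J ⊆ I →
    (∀ j ∈ J, f j ∈ I) → (∀ i ∈ J, ∀ j ∈ J, f i = f j → i = j) → (∀ i ∈ J, ∀ j ∈ J, f i ≠ j) →
    (I.powerset.filter fun S => ∀ j ∈ J, ¬ (j ∈ S ∧ f j ∈ S)).card * 4 ^ J.card ≤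
      3 ^ J.card * 2 ^ I.card := by
  induction J using Finset.induction_on with
  | empty => intro I _ _ _ _; simp
  | insert a J ha ih =>
    intro I hJ hf hinj hne
    have hab : f a ≠ a := hne a (by simp) a (by simp)
    have haI : a ∈ I := hJ (by simp)
    have hbI : f a ∈ I := hf a (by simp)
    set I' := (I.erase a).erase (f a) with hI'
    have hcard : I.card = I'.card + 2 := by
      have h1 := Finset.card_erase_add_one haI
      have h2 := Finset.card_erase_add_one (Finset.mem_erase.2 ⟨hab, hbI⟩)
      rw [← hI'] at h2
      omega
    have hJ' : J ⊆ I' := fun j hj => by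
      refine Finset.mem_erase.2 ⟨?_, Finset.mem_erase.2 ⟨?_, hJ (by simp [hj])⟩⟩
      · exact (hne a (by simp) j (by simp [hj])).symm
      · rintro rfl; exact ha hj
    have hf' : ∀ j ∈ J, f j ∈ I' := fun j hj => by
      refine Finset.mem_erase.2 ⟨?_, Finset.mem_erase.2 ⟨?_, hf j (by simp [hj])⟩⟩
      · intro h
        have := hinj j (by simp [hj]) a (by simp) h
        exact ha (this ▸ hj)
      · exact hne j (by simp [hj]) a (by simp)
    have hIH := ih I' hJ' hf'
      (fun i hi j hj => hinj i (by simp [hi]) j (by simp [hj]))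
      (fun i hi j hj => hne i (by simp [hi]) j (by simp [hj]))
    set G := I'.powerset.filter fun S => ∀ j ∈ J, ¬ (j ∈ S ∧ f j ∈ S) with hG
    have hle : (I.powerset.filter fun S => ∀ j ∈ insert a J, ¬ (j ∈ S ∧ f j ∈ S)).card ≤
        3 * G.card := by
      have h3 : ({∅, {a}, {f a}} : Finset (Finset ℤ)).card ≤ 3 := Finset.card_le_three
      refine le_trans ?_ (Nat.mul_le_mul_right _ h3)
      rw [← Finset.card_product]
      -- Of the four traces of S on the pair {a, f a}, the full one is excluded.
      refine Finset.card_le_card_of_injOn (fun S => (S ∩ {a, f a}, S \ {a, f a})) ?_ ?_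
      · intro S hS
        simp only [Finset.coe_filter, Finset.mem_powerset, Set.mem_ofPred_eq] at hS
        obtain ⟨hSI, hS⟩ := hS
        have hSa := hS a (by simp)
        simp only [Finset.coe_product, Set.mem_prod, Finset.mem_coe]
        constructor
        · simp only [Finset.mem_insert, Finset.mem_singleton]
          by_cases h1 : a ∈ S
          · have h2 : f a ∉ S := fun h => hSa ⟨h1, h⟩
            right; left
            ext x; simp only [Finset.mem_inter, Finset.mem_insert, Finset.mem_singleton]
            constructor
            · rintro ⟨hx, rfl | rfl⟩
              · rfl
              · exact absurd hx h2
            · rintro rfl; exact ⟨h1, .inl rfl⟩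
          · by_cases h2 : f a ∈ S
            · right; right
              ext x; simp only [Finset.mem_inter, Finset.mem_insert, Finset.mem_singleton]
              constructor
              · rintro ⟨hx, rfl | rfl⟩
                · exact absurd hx h1
                · rfl
              · rintro rfl; exact ⟨h2, .inr rfl⟩
            · left
              ext x; simp only [Finset.mem_inter, Finset.mem_insert, Finset.mem_singleton,
                Finset.notMem_empty, iff_false]
              rintro ⟨hx, rfl | rfl⟩
              · exact h1 hx
              · exact h2 hx
        · rw [hG, Finset.mem_filter, Finset.mem_powerset]
          refine ⟨fun x hx => ?_, fun j hj h => hS j (by simp [hj]) ?_⟩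
          · simp only [Finset.mem_sdiff, Finset.mem_insert, Finset.mem_singleton, not_or] at hx
            exact Finset.mem_erase.2 ⟨hx.2.2, Finset.mem_erase.2 ⟨hx.2.1, hSI hx.1⟩⟩
          · exact ⟨(Finset.mem_sdiff.1 h.1).1, (Finset.mem_sdiff.1 h.2).1⟩
      · intro S _ T _ h
        simp only [Prod.mk.injEq] at h
        rw [← Finset.sdiff_union_inter S {a, f a}, ← Finset.sdiff_union_inter T {a, f a}, h.1, h.2]
    rw [Finset.card_insert_of_notMem ha, hcard, pow_succ, pow_succ, pow_add]
    nlinarith [hle, hIH, pow_pos (show 0 < 4 by norm_num) J.card]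

/-- The sums and differences of `S ⊆ [0, n]` at distance at least `a` from the ends of `[0, 2n]`
and `[-n, n]` are all present. -/
def MiddleFull (n a : ℕ) (S : Finset ℤ) : Prop :=
  ∀ t : ℤ, (a : ℤ) ≤ t → t ≤ n → t ∈ S + S ∧ 2 * n - t ∈ S + S ∧ n - t ∈ S - S

theorem card_interval (n : ℕ) : (interval n).card = n + 1 := by
  simp [interval]

/-- If `2 m ≥ t` disjoint pairs of `[0, n]` are given, then the random set with `k` removed
avoids all of them with exponentially small probability in `t`. -/
theorem card_filter_erase_no_pair_le {n t : ℕ} (k g : ℤ) (f : ℤ → ℤ) (J : Finset ℤ)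
    (hJ : J ⊆ interval n) (hf : ∀ j ∈ J, f j ∈ interval n)
    (hinj : ∀ i ∈ J, ∀ j ∈ J, f i = f j → i = j) (hne : ∀ i ∈ J, ∀ j ∈ J, f i ≠ j)
    (hg : ∀ j, f j = k → j = g) (ht : t ≤ 2 * J.card) (P : Finset ℤ → Prop) [DecidablePred P]
    (hP : ∀ S, P S → ∀ j ∈ J, ¬ (j ∈ S.erase k ∧ f j ∈ S.erase k)) :
    (((interval n).powerset.filter P).card : ℝ) ≤ 2 * (9 / 10) ^ t * 2 ^ (n + 1) := by
  -- Only the pairs starting at k or g can involve k. Dropping them costs at most two pairs, paid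
  -- for by the factor 2, since 2 (9/10)^4 ≥ 1; also 3/4 ≤ (9/10)^2.
  set J' := J \ {k, g} with hJ'
  have hsub : J' ⊆ J := Finset.sdiff_subset
  have hcard : t ≤ 2 * J'.card + 4 := by
    have h1 : J.card - ({k, g} : Finset ℤ).card ≤ J'.card := Finset.le_card_sdiff _ _
    have h2 : ({k, g} : Finset ℤ).card ≤ 2 := Finset.card_le_two
    omega
  have h := card_filter_no_pair_mul_le f J' (interval n) (hsub.trans hJ)
    (fun j hj => hf j (hsub hj)) (fun i hi j hj => hinj i (hsub hi) j (hsub hj))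
    (fun i hi j hj => hne i (hsub hi) j (hsub hj))
  rw [card_interval] at h
  have hle : ((interval n).powerset.filter P).card ≤
      ((interval n).powerset.filter fun S => ∀ j ∈ J', ¬ (j ∈ S ∧ f j ∈ S)).card := by
    refine Finset.card_le_card fun S hS => ?_
    rw [Finset.mem_filter] at hS ⊢
    refine ⟨hS.1, fun j hj hjS => hP S hS.2 j (hsub hj) ?_⟩
    simp only [hJ', Finset.mem_sdiff, Finset.mem_insert, Finset.mem_singleton, not_or] at hj
    exact ⟨Finset.mem_erase.2 ⟨hj.2.1, hjS.1⟩,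
      Finset.mem_erase.2 ⟨fun h => hj.2.2 (hg j h), hjS.2⟩⟩
  have h' : (((interval n).powerset.filter P).card : ℝ) * 4 ^ J'.card ≤
      3 ^ J'.card * 2 ^ (n + 1) := by
    exact_mod_cast (Nat.mul_le_mul_right _ hle).trans h
  have h4 : (0 : ℝ) < 4 ^ J'.card := by positivity
  rw [← le_div_iff₀ h4, mul_div_right_comm, ← div_pow] at h'
  refine h'.trans (mul_le_mul_of_nonneg_right ?_ (by positivity))
  calc (3 / 4 : ℝ) ^ J'.card ≤ ((9 / 10) ^ 2) ^ J'.card := by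
        gcongr; norm_num
    _ = (9 / 10) ^ (2 * J'.card) := by rw [pow_mul]
    _ ≤ 2 * ((9 / 10) ^ (2 * J'.card) * (9 / 10) ^ 4) := by
        have : (0 : ℝ) < (9 / 10) ^ (2 * J'.card) := by positivity
        nlinarith
    _ ≤ 2 * (9 / 10) ^ t := by
        rw [← pow_add]
        gcongr ?_ * ?_
        exact pow_le_pow_of_le_one (by norm_num) (by norm_num) hcard

theorem card_filter_low_sum_missing_le {n t : ℕ} (k : ℤ) (ht : t ≤ n) :
    (((interval n).powerset.filter fun S => (t : ℤ) ∉ S.erase k + S.erase k).card : ℝ) ≤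
      2 * (9 / 10) ^ t * 2 ^ (n + 1) := by
  refine card_filter_erase_no_pair_le k (t - k) (fun j => t - j)
    (Finset.Ico 0 (((t + 1) / 2 : ℕ) : ℤ)) ?_ ?_ ?_ ?_ ?_ ?_ _ ?_
  · intro j hj
    simp only [interval, Finset.mem_Ico, Finset.mem_Icc] at *
    omega
  · intro j hj
    simp only [interval, Finset.mem_Ico, Finset.mem_Icc] at *
    omega
  · intro i _ j _ h
    omega
  · intro i hi j hj
    simp only [Finset.mem_Ico] at *
    omega
  · intro j h
    omega
  · rw [Int.card_Ico]
    omega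
  · exact fun S hS j _ h => hS (Finset.mem_add.2 ⟨j, h.1, _, h.2, by ring⟩)

theorem card_filter_high_sum_missing_le {n t : ℕ} (k : ℤ) (ht : t ≤ n) :
    (((interval n).powerset.filter fun S => (2 * n - t : ℤ) ∉ S.erase k + S.erase k).card : ℝ) ≤
      2 * (9 / 10) ^ t * 2 ^ (n + 1) := by
  refine card_filter_erase_no_pair_le k (2 * n - t - k) (fun j => 2 * n - t - j)
    (Finset.Ioc (n - ((t + 1) / 2 : ℕ) : ℤ) n) ?_ ?_ ?_ ?_ ?_ ?_ _ ?_
  · intro j hj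
    simp only [interval, Finset.mem_Ioc, Finset.mem_Icc] at *
    omega
  · intro j hj
    simp only [interval, Finset.mem_Ioc, Finset.mem_Icc] at *
    omega
  · intro i _ j _ h
    omega
  · intro i hi j hj
    simp only [Finset.mem_Ioc] at *
    omega
  · intro j h
    omega
  · rw [Int.card_Ioc]
    omega
  · exact fun S hS j _ h => hS (Finset.mem_add.2 ⟨j, h.1, _, h.2, by ring⟩)

theorem card_filter_difference_missing_le {n t : ℕ} (k : ℤ) (ht : t < n) :
    (((interval n).powerset.filter fun S => (n - t : ℤ) ∉ S.erase k - S.erase k).card : ℝ) ≤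
      2 * (9 / 10) ^ t * 2 ^ (n + 1) := by
  set e : ℤ := n - t with he
  have he0 : 0 < e := by omega
  refine card_filter_erase_no_pair_le k (k - e) (fun j => j + e)
    -- The pairs (j, j + e) overlap in chains of step e. Keeping j in every second block of length e
    -- makes them disjoint and retains at least half, as j ↦ j - e sends odd blocks into even ones.
    ((Finset.Icc 0 (t : ℤ)).filter fun j => (j / e) % 2 = 0) ?_ ?_ ?_ ?_ ?_ ?_ _ ?_
  · intro j hj
    simp only [interval, Finset.mem_filter, Finset.mem_Icc] at *
    omega
  · intro j hj
    simp only [interval, Finset.mem_filter, Finset.mem_Icc] at *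
    omega
  · intro i _ j _ h
    simpa using h
  · intro i hi j hj h
    simp only [Finset.mem_filter, Finset.mem_Icc] at *
    rw [← h, Int.add_ediv_of_dvd_right dvd_rfl, Int.ediv_self he0.ne'] at hj
    omega
  · intro j h
    omega
  · have h1 := Finset.card_filter_add_card_filter_not (s := Finset.Icc 0 (t : ℤ))
      (fun j => (j / e) % 2 = 0)
    have h2 : ((Finset.Icc 0 (t : ℤ)).filter fun j => ¬ (j / e) % 2 = 0).card ≤
        ((Finset.Icc 0 (t : ℤ)).filter fun j => (j / e) % 2 = 0).card := by
      refine Finset.card_le_card_of_injOn (fun j => j - e) ?_ (fun i _ j _ h => by simpa using h)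
      intro j hj
      simp only [Finset.coe_filter, Finset.mem_Icc, Set.mem_ofPred_eq] at hj ⊢
      have h3 : e ≤ j := by
        by_contra h
        exact hj.2 (by rw [Int.ediv_eq_zero_of_lt hj.1.1 (by omega)]; rfl)
      rw [Int.sub_ediv_of_dvd _ dvd_rfl, Int.ediv_self he0.ne']
      omega
    rw [Int.card_Icc] at h1
    omega
  · exact fun S hS j _ h => hS (Finset.mem_sub.2 ⟨_, h.2, j, h.1, by ring⟩)

open Classical in
/-- Almost every set has all its middle sums and differences, even after removal of `k`. -/
theorem card_filter_not_middleFull_le (n a : ℕ) (k : ℤ) :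
    (((interval n).powerset.filter fun S => ¬ MiddleFull n a (S.erase k)).card : ℝ) ≤
      60 * (9 / 10) ^ a * 2 ^ (n + 1) := by
  set E₁ : ℕ → Finset (Finset ℤ) := fun t =>
    (interval n).powerset.filter fun S => (t : ℤ) ∉ S.erase k + S.erase k
  set E₂ : ℕ → Finset (Finset ℤ) := fun t =>
    (interval n).powerset.filter fun S => (2 * n - t : ℤ) ∉ S.erase k + S.erase k
  set E₃ : ℕ → Finset (Finset ℤ) := fun t =>
    (interval n).powerset.filter fun S => t < n ∧ (n - t : ℤ) ∉ S.erase k - S.erase k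
  have hsub : ((interval n).powerset.filter fun S => ¬ MiddleFull n a (S.erase k)) ⊆
      (Finset.Ico a (n + 1)).biUnion fun t => E₁ t ∪ (E₂ t ∪ E₃ t) := by
    intro S hS
    obtain ⟨hSI, hS⟩ := Finset.mem_filter.1 hS
    by_contra hcon
    simp only [Finset.mem_biUnion, Finset.mem_Ico, Finset.mem_union, E₁, E₂, E₃,
      Finset.mem_filter, hSI, true_and, not_exists, not_and, not_or, not_not] at hcon
    refine hS fun t hat htn => ?_
    lift t to ℕ using by omega
    obtain ⟨h1, h2, h3⟩ := hcon t ⟨by omega, by omega⟩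
    refine ⟨h1, h2, ?_⟩
    rcases (show t ≤ n by omega).lt_or_eq with h | rfl
    · exact h3 h
    -- For t = n the difference is 0, which only needs a nonempty set.
    · obtain ⟨x, hx, -⟩ := Finset.mem_add.1 h1
      exact Finset.mem_sub.2 ⟨x, hx, x, hx, by ring⟩
  have hE : ∀ t ∈ Finset.Ico a (n + 1), ((E₁ t ∪ (E₂ t ∪ E₃ t)).card : ℝ) ≤
      6 * 2 ^ (n + 1) * (9 / 10) ^ t := by
    intro t ht
    have htn : t ≤ n := by have := Finset.mem_Ico.1 ht; omega
    have h1 := card_filter_low_sum_missing_le k htn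
    have h2 := card_filter_high_sum_missing_le k htn
    have h3 : ((E₃ t).card : ℝ) ≤ 2 * (9 / 10) ^ t * 2 ^ (n + 1) := by
      rcases htn.lt_or_eq with h | h
      · simpa only [E₃, h, true_and] using card_filter_difference_missing_le k h
      · simp only [E₃, h, lt_irrefl, false_and, Finset.filter_false, Finset.card_empty]
        simp only [Nat.cast_zero]
        positivity
    have h4 : ((E₁ t ∪ (E₂ t ∪ E₃ t)).card : ℝ) ≤ (E₁ t).card + ((E₂ t).card + (E₃ t).card) := by
      exact_mod_cast (Finset.card_union_le _ _).trans
        (Nat.add_le_add_left (Finset.card_union_le _ _) _)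
    have h1' : ((E₁ t).card : ℝ) ≤ 2 * (9 / 10) ^ t * 2 ^ (n + 1) := h1
    have h2' : ((E₂ t).card : ℝ) ≤ 2 * (9 / 10) ^ t * 2 ^ (n + 1) := h2
    linarith
  have hgeom : ∑ t ∈ Finset.Ico a (n + 1), (9 / 10 : ℝ) ^ t ≤ 10 * (9 / 10) ^ a := by
    have := geom_sum_Ico_le_of_lt_one (x := (9 / 10 : ℝ)) (m := a) (n := n + 1)
      (by norm_num) (by norm_num)
    refine this.trans (le_of_eq ?_)
    ring
  calc (((interval n).powerset.filter fun S => ¬ MiddleFull n a (S.erase k)).card : ℝ)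
      ≤ ((Finset.Ico a (n + 1)).biUnion fun t => E₁ t ∪ (E₂ t ∪ E₃ t)).card := by
        exact_mod_cast Finset.card_le_card hsub
    _ ≤ ∑ t ∈ Finset.Ico a (n + 1), ((E₁ t ∪ (E₂ t ∪ E₃ t)).card : ℝ) := by
        exact_mod_cast Finset.card_biUnion_le
    _ ≤ ∑ t ∈ Finset.Ico a (n + 1), 6 * 2 ^ (n + 1) * (9 / 10 : ℝ) ^ t := Finset.sum_le_sum hE
    _ = 6 * 2 ^ (n + 1) * ∑ t ∈ Finset.Ico a (n + 1), (9 / 10 : ℝ) ^ t := by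
        rw [Finset.mul_sum]
    _ ≤ 6 * 2 ^ (n + 1) * (10 * (9 / 10) ^ a) := by gcongr
    _ = 60 * (9 / 10) ^ a * 2 ^ (n + 1) := by ring

/-! ### Toggling a middle element -/

theorem MiddleFull.mono {n a : ℕ} {S T : Finset ℤ} (h : MiddleFull n a S) (hST : S ⊆ T) :
    MiddleFull n a T := fun t h1 h2 =>
  ⟨Finset.add_subset_add hST hST (h t h1 h2).1, Finset.add_subset_add hST hST (h t h1 h2).2.1,
    Finset.sub_subset_sub hST hST (h t h1 h2).2.2⟩

theorem MiddleFull.mem_add {n a : ℕ} {S : Finset ℤ} (h : MiddleFull n a S) {x : ℤ}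
    (h1 : a ≤ x) (h2 : x ≤ 2 * n - a) : x ∈ S + S := by
  rcases le_total x n with hx | hx
  · exact (h x h1 hx).1
  · have := (h (2 * n - x) (by omega) (by omega)).2.1
    rwa [sub_sub_cancel] at this

theorem MiddleFull.mem_sub {n a : ℕ} {S : Finset ℤ} (h : MiddleFull n a S) {x : ℤ}
    (h1 : a - n ≤ x) (h2 : x ≤ n - a) : x ∈ S - S := by
  rcases le_total 0 x with hx | hx
  · have := (h (n - x) (by omega) (by omega)).2.2
    rwa [sub_sub_cancel] at this
  · have := (h (n + x) (by omega) (by omega)).2.2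
    obtain ⟨u, hu, v, hv, huv⟩ := Finset.mem_sub.1 this
    exact Finset.mem_sub.2 ⟨v, hv, u, hu, by omega⟩

theorem mem_interval {n : ℕ} {x : ℤ} : x ∈ interval n ↔ 0 ≤ x ∧ x ≤ n := Finset.mem_Icc

/-- Toggling a middle element does not affect the missing sums and differences of a set whose
middle is full. -/
theorem missing_erase_of_middleFull {n a : ℕ} {k : ℤ} {S : Finset ℤ} (hS : S ⊆ interval n)
    (h1 : a < k) (h2 : k < n - a) (hm : MiddleFull n a (S.erase k)) :
    missing n (S.erase k) = missing n S := by
  have hbd : ∀ x ∈ S, 0 ≤ x ∧ x ≤ n := fun x hx => mem_interval.1 (hS hx)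
  have hsub : S.erase k ⊆ S := Finset.erase_subset _ _
  have hadd : S.erase k + S.erase k = S + S := by
    refine (Finset.add_subset_add hsub hsub).antisymm fun x hx => ?_
    obtain ⟨u, hu, v, hv, rfl⟩ := Finset.mem_add.1 hx
    by_cases hk : u = k ∨ v = k
    · have := hbd u hu
      have := hbd v hv
      exact hm.mem_add (by omega) (by omega)
    · exact Finset.add_mem_add (Finset.mem_erase.2 ⟨by tauto, hu⟩)
        (Finset.mem_erase.2 ⟨by tauto, hv⟩)
  have hdiff : S.erase k - S.erase k = S - S := by
    refine (Finset.sub_subset_sub hsub hsub).antisymm fun x hx => ?_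
    obtain ⟨u, hu, v, hv, rfl⟩ := Finset.mem_sub.1 hx
    by_cases hk : u = k ∨ v = k
    · have := hbd u hu
      have := hbd v hv
      exact hm.mem_sub (by omega) (by omega)
    · exact Finset.sub_mem_sub (Finset.mem_erase.2 ⟨by tauto, hu⟩)
        (Finset.mem_erase.2 ⟨by tauto, hv⟩)
  rw [missing, missing, hadd, hdiff]

open Classical in
/-- The sets with `missing n S ∈ Λ` that contain `k` are about half of all of them. -/
theorem abs_two_mul_card_sub_card_le {n a : ℕ} {k : ℤ} (Λ : Set (ℕ × ℕ)) (h1 : a < k)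
    (h2 : k < n - a) :
    |2 * (((interval n).powerset.filter fun S => k ∈ S ∧ missing n S ∈ Λ).card : ℝ) -
      ((interval n).powerset.filter fun S => missing n S ∈ Λ).card| ≤
      60 * (9 / 10) ^ a * 2 ^ (n + 1) := by
  set X := (interval n).powerset.filter fun S => k ∈ S ∧ missing n S ∈ Λ with hX
  set Y := (interval n).powerset.filter fun S => k ∉ S ∧ missing n S ∈ Λ with hY
  set Bad := (interval n).powerset.filter fun S => ¬ MiddleFull n a (S.erase k) with hBad
  have hkI : k ∈ interval n := mem_interval.2 (by omega)
  have hN : ((interval n).powerset.filter fun S => missing n S ∈ Λ).card = X.card + Y.card := by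
    rw [← Finset.card_filter_add_card_filter_not (fun S => k ∈ S), Finset.filter_filter,
      Finset.filter_filter]
    simp only [and_comm, hX, hY]
  have hXY : (X \ Bad).card ≤ Y.card := by
    refine Finset.card_le_card_of_injOn (fun S => S.erase k) ?_ ?_
    · intro S hS
      simp only [hX, hY, hBad, Finset.coe_sdiff, Finset.coe_filter, Finset.mem_powerset,
        Set.mem_sdiff, Set.mem_ofPred_eq, not_and, not_not] at hS ⊢
      obtain ⟨⟨hSI, -, hS⟩, hm⟩ := hS
      exact ⟨(Finset.erase_subset _ _).trans hSI, Finset.notMem_erase _ _,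
        (missing_erase_of_middleFull hSI h1 h2 (hm hSI)).symm ▸ hS⟩
    · intro S hS T hT h
      have hS' : k ∈ S := (Finset.mem_filter.1 (Finset.mem_sdiff.1 hS).1).2.1
      have hT' : k ∈ T := (Finset.mem_filter.1 (Finset.mem_sdiff.1 hT).1).2.1
      rw [← Finset.insert_erase hS', ← Finset.insert_erase hT']
      exact congrArg (insert k) h
  have hYX : (Y \ Bad).card ≤ X.card := by
    refine Finset.card_le_card_of_injOn (fun S => insert k S) ?_ ?_
    · intro S hS
      simp only [hX, hY, hBad, Finset.coe_sdiff, Finset.coe_filter, Finset.mem_powerset,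
        Set.mem_sdiff, Set.mem_ofPred_eq, not_and, not_not] at hS ⊢
      obtain ⟨⟨hSI, hkS, hS⟩, hm⟩ := hS
      have hI : insert k S ⊆ interval n := Finset.insert_subset hkI hSI
      have hm' : MiddleFull n a ((insert k S).erase k) := by
        rw [Finset.erase_insert hkS]
        simpa only [Finset.erase_eq_of_notMem hkS] using hm hSI
      have := missing_erase_of_middleFull hI h1 h2 hm'
      rw [Finset.erase_insert hkS] at this
      exact ⟨hI, Finset.mem_insert_self _ _, this ▸ hS⟩
    · intro S hS T hT h
      have hS' : k ∉ S := (Finset.mem_filter.1 (Finset.mem_sdiff.1 hS).1).2.1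
      have hT' : k ∉ T := (Finset.mem_filter.1 (Finset.mem_sdiff.1 hT).1).2.1
      rw [← Finset.erase_insert hS', ← Finset.erase_insert hT']
      exact congrArg (fun U => U.erase k) h
  have e1 : X.card ≤ (X \ Bad).card + Bad.card := Finset.card_le_card_sdiff_add_card
  have e2 : Y.card ≤ (Y \ Bad).card + Bad.card := Finset.card_le_card_sdiff_add_card
  have e3 : (X.card : ℝ) ≤ Y.card + Bad.card := by exact_mod_cast (by omega : X.card ≤ _)
  have e4 : (Y.card : ℝ) ≤ X.card + Bad.card := by exact_mod_cast (by omega : Y.card ≤ _)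
  refine le_trans ?_ (card_filter_not_middleFull_le n a k)
  rw [hN, abs_le]
  push_cast
  constructor <;> linarith

/-! ### From fringes to a positive proportion of sets -/

/-- A set with full middle has the missing sums and differences prescribed by its fringes. -/
theorem missing_eq_of_fringes {n l : ℕ} {S A B : Finset ℤ} (hS : S ⊆ interval n)
    (hn : 2 * l ≤ n) (hA : ∀ x : ℤ, x < l → (x ∈ S ↔ x ∈ A))
    (hB : ∀ x : ℤ, x < l → ((n : ℤ) - x ∈ S ↔ x ∈ B)) (hm : MiddleFull n l S)
    (hA' : ∀ x ∈ A, 0 ≤ x ∧ x < l) (hB' : ∀ x ∈ B, 0 ≤ x ∧ x < l) :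
    missing n S = ((Finset.Ico 0 (l : ℤ) \ (A + A)).card + (Finset.Ico 0 (l : ℤ) \ (B + B)).card,
      2 * (Finset.Ico 0 (l : ℤ) \ (A + B)).card) := by
  have hbd : ∀ x ∈ S, 0 ≤ x ∧ x ≤ n := fun x hx => mem_interval.1 (hS hx)
  have lowSum : ∀ x : ℤ, x < l → (x ∈ S + S ↔ x ∈ A + A) := by
    intro x hx
    simp only [Finset.mem_add]
    constructor
    · rintro ⟨u, hu, v, hv, rfl⟩
      have := hbd u hu
      have := hbd v hv
      exact ⟨u, (hA u (by omega)).1 hu, v, (hA v (by omega)).1 hv, rfl⟩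
    · rintro ⟨u, hu, v, hv, rfl⟩
      exact ⟨u, (hA u (hA' u hu).2).2 hu, v, (hA v (hA' v hv).2).2 hv, rfl⟩
  have highSum : ∀ x : ℤ, x < l → (2 * n - x ∈ S + S ↔ x ∈ B + B) := by
    intro x hx
    simp only [Finset.mem_add]
    constructor
    · rintro ⟨u, hu, v, hv, h⟩
      have := hbd u hu
      have := hbd v hv
      exact ⟨n - u, (hB _ (by omega)).1 (by simpa using hu), n - v,
        (hB _ (by omega)).1 (by simpa using hv), by omega⟩
    · rintro ⟨u, hu, v, hv, rfl⟩
      exact ⟨n - u, (hB u (hB' u hu).2).2 hu, n - v, (hB v (hB' v hv).2).2 hv, by ring⟩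
  have diff : ∀ x : ℤ, x < l → (n - x ∈ S - S ↔ x ∈ A + B) := by
    intro x hx
    simp only [Finset.mem_add, Finset.mem_sub]
    constructor
    · rintro ⟨u, hu, v, hv, h⟩
      have := hbd u hu
      have := hbd v hv
      exact ⟨v, (hA v (by omega)).1 hv, n - u, (hB _ (by omega)).1 (by simpa using hu), by omega⟩
    · rintro ⟨u, hu, v, hv, rfl⟩
      exact ⟨n - v, (hB v (hB' v hv).2).2 hv, u, (hA u (hA' u hu).2).2 hu, by ring⟩
  have diffNeg : ∀ x : ℤ, -x ∈ S - S ↔ x ∈ S - S := fun x => by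
    simp only [Finset.mem_sub]
    constructor <;> rintro ⟨u, hu, v, hv, h⟩ <;> exact ⟨v, hv, u, hu, by omega⟩
  have hsums : Finset.Icc 0 (2 * n : ℤ) \ (S + S) = (Finset.Ico 0 (l : ℤ) \ (A + A)) ∪
      (Finset.Ico 0 (l : ℤ) \ (B + B)).image fun x => 2 * (n : ℤ) - x := by
    ext x
    simp only [Finset.mem_sdiff, Finset.mem_Icc, Finset.mem_union, Finset.mem_Ico,
      Finset.mem_image]
    constructor
    · rintro ⟨hx, hxS⟩
      rcases lt_or_ge x l with h1 | h1
      · exact .inl ⟨by omega, fun h => hxS ((lowSum x h1).2 h)⟩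
      · rcases le_or_gt x (2 * n - l) with h2 | h2
        · exact absurd (hm.mem_add h1 h2) hxS
        · refine .inr ⟨2 * n - x, ⟨by omega, fun h => hxS ?_⟩, by ring⟩
          simpa using (highSum (2 * n - x) (by omega)).2 h
    · rintro (⟨hx, hxA⟩ | ⟨y, ⟨hy, hyB⟩, rfl⟩)
      · exact ⟨by omega, fun h => hxA ((lowSum x hx.2).1 h)⟩
      · exact ⟨by omega, fun h => hyB ((highSum y hy.2).1 h)⟩
  have hdiffs : Finset.Icc (-n : ℤ) n \ (S - S) =
      ((Finset.Ico 0 (l : ℤ) \ (A + B)).image fun x => (n : ℤ) - x) ∪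
      (Finset.Ico 0 (l : ℤ) \ (A + B)).image fun x => x - (n : ℤ) := by
    ext x
    simp only [Finset.mem_sdiff, Finset.mem_Icc, Finset.mem_union, Finset.mem_Ico,
      Finset.mem_image]
    constructor
    · rintro ⟨hx, hxS⟩
      rcases lt_or_ge x (l - n) with h1 | h1
      · refine .inr ⟨n + x, ⟨by omega, fun h => hxS ?_⟩, by ring⟩
        rw [← diffNeg]
        simpa using (diff (n + x) (by omega)).2 h
      · rcases le_or_gt x (n - l) with h2 | h2
        · exact absurd (hm.mem_sub h1 h2) hxS
        · refine .inl ⟨n - x, ⟨by omega, fun h => hxS ?_⟩, by ring⟩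
          simpa using (diff (n - x) (by omega)).2 h
    · rintro (⟨y, ⟨hy, hyB⟩, rfl⟩ | ⟨y, ⟨hy, hyB⟩, rfl⟩)
      · exact ⟨by omega, fun h => hyB ((diff y hy.2).1 h)⟩
      · refine ⟨by omega, fun h => hyB ((diff y hy.2).1 ?_)⟩
        rw [← diffNeg]
        simpa using h
  have c1 := congrArg Finset.card hsums
  have c2 := congrArg Finset.card hdiffs
  rw [Finset.card_union_of_disjoint, Finset.card_image_of_injective _ (sub_right_injective),
    Finset.card_sdiff_of_subset, Int.card_Icc] at c1
  rotate_left
  · intro x hx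
    obtain ⟨u, hu, v, hv, rfl⟩ := Finset.mem_add.1 hx
    have := hbd u hu
    have := hbd v hv
    exact Finset.mem_Icc.2 (by omega)
  · rw [Finset.disjoint_left]
    intro x hx hx'
    simp only [Finset.mem_sdiff, Finset.mem_Ico, Finset.mem_image] at hx hx'
    obtain ⟨y, hy, rfl⟩ := hx'
    omega
  rw [Finset.card_union_of_disjoint, Finset.card_image_of_injective _ (sub_right_injective),
    Finset.card_image_of_injective _ (sub_left_injective),
    Finset.card_sdiff_of_subset, Int.card_Icc] at c2
  rotate_left
  · intro x hx
    obtain ⟨u, hu, v, hv, rfl⟩ := Finset.mem_sub.1 hx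
    have := hbd u hu
    have := hbd v hv
    exact Finset.mem_Icc.2 (by omega)
  · rw [Finset.disjoint_left]
    intro x hx hx'
    simp only [Finset.mem_sdiff, Finset.mem_Ico, Finset.mem_image] at hx hx'
    obtain ⟨y, hy, rfl⟩ := hx
    obtain ⟨z, hz, h⟩ := hx'
    omega
  rw [missing, Prod.mk.injEq]
  omega

/-- The set with low fringe `A`, middle part `V` shifted by `l`, and high fringe `n - B`. -/
def glue (n l : ℕ) (A B V : Finset ℤ) : Finset ℤ :=
  A ∪ V.image (fun x => x + (l : ℤ)) ∪ B.image fun x => (n : ℤ) - x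

theorem mem_glue {n l : ℕ} {A B V : Finset ℤ} {x : ℤ} :
    x ∈ glue n l A B V ↔ x ∈ A ∨ x - l ∈ V ∨ n - x ∈ B := by
  simp only [glue, Finset.mem_union, Finset.mem_image, or_assoc]
  refine or_congr Iff.rfl (or_congr ⟨?_, fun h => ⟨_, h, by ring⟩⟩ ⟨?_, fun h => ⟨_, h, by ring⟩⟩)
  · rintro ⟨y, hy, rfl⟩
    simpa using hy
  · rintro ⟨y, hy, rfl⟩
    simpa using hy

/-- The threshold drops from a to l because V contains both end segments: for l ≤ t ≤ l + a, add the
endpoints 0 and n = m + 2l of the glued set to shifted elements of these segments. For larger t,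
representations in V at t - 2l are shifted. -/
theorem middleFull_glue {m l a : ℕ} {A B V : Finset ℤ} (hA : 0 ∈ A) (hB : 0 ∈ B)
    (hla : l ≤ a) (hlow : ∀ x : ℤ, 0 ≤ x → x ≤ a → x ∈ V)
    (hhigh : ∀ x : ℤ, 0 ≤ x → x ≤ a → m - x ∈ V) (hm : MiddleFull m a V) :
    MiddleFull (m + 2 * l) l (glue (m + 2 * l) l A B V) := by
  set S := glue (m + 2 * l) l A B V
  have h0 : (0 : ℤ) ∈ S := mem_glue.2 (.inl hA)
  have hn : ((m + 2 * l : ℕ) : ℤ) ∈ S := mem_glue.2 (.inr (.inr (by simpa using hB)))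
  have hV : ∀ x ∈ V, x + l ∈ S := fun x hx => mem_glue.2 (.inr (.inl (by simpa using hx)))
  intro t h1 h2
  push_cast at *
  rcases le_total t (l + a) with h3 | h3
  · have e1 : t ∈ S := by simpa using hV _ (hlow (t - l) (by omega) (by omega))
    have e2 : (m + 2 * l - t : ℤ) ∈ S := by
      have := hV _ (hhigh (t - l) (by omega) (by omega))
      rwa [show (m + 2 * l - t : ℤ) = m - (t - l) + l by ring]
    exact ⟨Finset.mem_add.2 ⟨0, h0, t, e1, by ring⟩, Finset.mem_add.2 ⟨_, hn, _, e2, by ring⟩,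
      Finset.mem_sub.2 ⟨_, hn, t, e1, by ring⟩⟩
  · have key : t - 2 * l ∈ V + V ∧ 2 * m - (t - 2 * l) ∈ V + V ∧ m - (t - 2 * l) ∈ V - V := by
      rcases le_total (t - 2 * l) a with h4 | h4
      · have e0 := hlow 0 le_rfl (by omega)
        have e1 := hhigh 0 le_rfl (by omega)
        have e2 := hlow (t - 2 * l) (by omega) h4
        have e3 := hhigh (t - 2 * l) (by omega) h4
        exact ⟨Finset.mem_add.2 ⟨_, e0, _, e2, by ring⟩, Finset.mem_add.2 ⟨_, e1, _, e3, by ring⟩,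
          Finset.mem_sub.2 ⟨_, e1, _, e2, by ring⟩⟩
      · exact hm _ h4 (by omega)
    simp only [Finset.mem_add, Finset.mem_sub] at key ⊢
    obtain ⟨⟨u, hu, v, hv, h⟩, ⟨u', hu', v', hv', h'⟩, ⟨u'', hu'', v'', hv'', h''⟩⟩ := key
    exact ⟨⟨_, hV u hu, _, hV v hv, by omega⟩, ⟨_, hV u' hu', _, hV v' hv', by omega⟩,
      ⟨_, hV u'' hu'', _, hV v'' hv'', by omega⟩⟩

open Classical in
/-- At least half of the subsets of `[0, m]` have full middle. -/
theorem exists_half_le_card_middleFull (l : ℕ) : ∃ a, l ≤ a ∧ ∀ m : ℕ,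
    (1 / 2 : ℝ) * 2 ^ (m + 1) ≤ ((interval m).powerset.filter fun S => MiddleFull m a S).card := by
  have hlim : Tendsto (fun a : ℕ => 60 * (9 / 10 : ℝ) ^ a) atTop (𝓝 (60 * 0)) :=
    (tendsto_pow_atTop_nhds_zero_of_lt_one (by norm_num) (by norm_num)).const_mul _
  obtain ⟨a, ha, hla⟩ := ((hlim.eventually_le_const (u := 1 / 2) (by norm_num)).and
    (eventually_ge_atTop l)).exists
  refine ⟨a, hla, fun m => ?_⟩
  -- Removing -1 from a subset of [0, m] changes nothing.
  have h1 := card_filter_not_middleFull_le m a (-1)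
  have h2 : ((interval m).powerset.filter fun S => ¬ MiddleFull m a (S.erase (-1))) =
      (interval m).powerset.filter fun S => ¬ MiddleFull m a S := by
    refine Finset.filter_congr fun S hS => ?_
    rw [Finset.erase_eq_of_notMem]
    intro h
    have := mem_interval.1 (Finset.mem_powerset.1 hS h)
    omega
  have h3 := Finset.card_filter_add_card_filter_not (s := (interval m).powerset)
    (fun S => MiddleFull m a S)
  rw [Finset.card_powerset, card_interval] at h3
  rw [h2] at h1
  have h4 : (((interval m).powerset.filter fun S => MiddleFull m a S).card : ℝ) +
      ((interval m).powerset.filter fun S => ¬ MiddleFull m a S).card = 2 ^ (m + 1) := by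
    exact_mod_cast h3
  have h5 : 60 * (9 / 10 : ℝ) ^ a * 2 ^ (m + 1) ≤ 1 / 2 * 2 ^ (m + 1) := by gcongr
  linarith

/-- A positive proportion of the subsets of `[0, n]` misses exactly `s` sums and `2 d`
differences. -/
theorem exists_le_card_missing_eq (s d : ℕ) : ∃ c : ℝ, 0 < c ∧ ∀ᶠ n : ℕ in atTop,
    c * 2 ^ (n + 1) ≤ ((interval n).powerset.filter fun S => missing n S = (s, 2 * d)).card := by
  classical
  obtain ⟨l, A, B, hAl, hBl, hA, hB, hs, hd⟩ := exists_fringes s d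
  obtain ⟨a, hla, ha⟩ := exists_half_le_card_middleFull l
  -- Half of the middles are full, the fringes fix 2l elements, and forcing W into the middle
  -- forgets at most 2a + 2 bits.
  refine ⟨1 / 2 / 2 ^ (2 * l) / 2 ^ (2 * a + 2), by positivity, ?_⟩
  filter_upwards [eventually_ge_atTop (a + 2 * l)] with n hn
  obtain ⟨m, rfl⟩ : ∃ m, n = m + 2 * l := ⟨n - 2 * l, by omega⟩
  have ham : a ≤ m := by omega
  set W : Finset ℤ := Finset.Icc 0 (a : ℤ) ∪ Finset.Icc ((m : ℤ) - a) m with hW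
  have hWcard : W.card ≤ 2 * a + 2 := by
    refine (Finset.card_union_le _ _).trans ?_
    rw [Int.card_Icc, Int.card_Icc]
    omega
  have hWI : W ⊆ interval m := by
    intro x hx
    simp only [hW, Finset.mem_union, Finset.mem_Icc] at hx
    exact mem_interval.2 (by omega)
  have hA' : ∀ x ∈ A, 0 ≤ x ∧ x < l := fun x hx => Finset.mem_Ico.1 (hAl hx)
  have hB' : ∀ x ∈ B, 0 ≤ x ∧ x < l := fun x hx => Finset.mem_Ico.1 (hBl hx)
  have hcount : ((interval m).powerset.filter fun S => MiddleFull m a S).card ≤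
      2 ^ (2 * a + 2) *
        ((interval (m + 2 * l)).powerset.filter
          fun S => missing (m + 2 * l) S = (s, 2 * d)).card := by
    refine le_trans ?_ (Nat.mul_le_mul_right _ (Nat.pow_le_pow_right two_pos hWcard))
    rw [← Finset.card_powerset, ← Finset.card_product]
    refine Finset.card_le_card_of_injOn
      (fun T => (T ∩ W, glue (m + 2 * l) l A B (T ∪ W))) ?_ ?_
    · intro T hT
      obtain ⟨hTI, hTm⟩ := Finset.mem_filter.1 (Finset.mem_coe.1 hT)
      rw [Finset.mem_powerset] at hTI
      have hV : ∀ x ∈ T ∪ W, 0 ≤ x ∧ x ≤ m := fun x hx =>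
        mem_interval.1 (Finset.union_subset hTI hWI hx)
      refine Finset.mem_coe.2 (Finset.mem_product.2 ⟨Finset.mem_powerset.2
        Finset.inter_subset_right, Finset.mem_filter.2 ⟨Finset.mem_powerset.2 ?_, ?_⟩⟩)
      · intro x hx
        rw [mem_interval]
        push_cast
        rcases mem_glue.1 hx with h | h | h
        · have := hA' _ h
          omega
        · have := hV _ h
          omega
        · have := hB' _ h
          push_cast at this
          omega
      · dsimp only
        rw [← hs, ← hd]
        refine missing_eq_of_fringes ?_ (by omega) ?_ ?_ ?_ hA' hB'
        · intro x hx
          rw [mem_interval]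
          push_cast
          rcases mem_glue.1 hx with h | h | h
          · have := hA' _ h
            omega
          · have := hV _ h
            omega
          · have := hB' _ h
            push_cast at this
            omega
        · intro x hx
          rw [mem_glue]
          refine ⟨?_, .inl⟩
          rintro (h | h | h)
          · exact h
          · have := hV _ h
            omega
          · have := hB' _ h
            push_cast at this
            omega
        · intro x hx
          rw [mem_glue]
          constructor
          · rintro (h | h | h)
            · have := hA' _ h
              push_cast at this
              omega
            · have := hV _ h
              push_cast at this
              omega
            · simpa using h
          · intro h
            exact .inr (.inr (by simpa using h))
        · refine middleFull_glue hA hB hla ?_ ?_ (hTm.mono Finset.subset_union_left)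
          · intro x h1 h2
            simp only [hW, Finset.mem_union, Finset.mem_Icc]
            omega
          · intro x h1 h2
            simp only [hW, Finset.mem_union, Finset.mem_Icc]
            omega
    -- T is recovered from its recorded trace on W and, off W, from the glued set.
    · have hrec : ∀ T ⊆ interval m, ∀ x, x ∈ T ↔ x ∈ T ∩ W ∨
          x ∉ W ∧ (0 ≤ x ∧ x ≤ m) ∧ x + l ∈ glue (m + 2 * l) l A B (T ∪ W) := by
        intro T hT x
        simp only [mem_glue, Finset.mem_inter, Finset.mem_union, add_sub_cancel_right]
        constructor
        · intro hx
          by_cases hxW : x ∈ W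
          · exact .inl ⟨hx, hxW⟩
          · exact .inr ⟨hxW, mem_interval.1 (hT hx), .inr (.inl (.inl hx))⟩
        · rintro (h | ⟨hxW, hx, h | (h | h) | h⟩)
          · exact h.1
          · have := hA' _ h
            omega
          · exact h
          · exact absurd h hxW
          · have := hB' _ h
            push_cast at this
            omega
      intro T hT U hU h
      simp only [Prod.mk.injEq] at h
      ext x
      rw [hrec T (Finset.mem_powerset.1 (Finset.mem_filter.1 hT).1), h.1, h.2,
        ← hrec U (Finset.mem_powerset.1 (Finset.mem_filter.1 hU).1)]
  have hcount' : (((interval m).powerset.filter fun S => MiddleFull m a S).card : ℝ) ≤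
      2 ^ (2 * a + 2) *
        ((interval (m + 2 * l)).powerset.filter
          fun S => missing (m + 2 * l) S = (s, 2 * d)).card := by exact_mod_cast hcount
  have h := (ha m).trans hcount'
  rw [mul_comm, ← div_le_iff₀' (by positivity)] at h
  refine le_trans (le_of_eq ?_) h
  rw [show m + 2 * l + 1 = 2 * l + (m + 1) by ring, pow_add 2 (2 * l)]
  field_simp

open Classical in
-- The limits
/-- The proportion of sets containing `k n`, among those with `missing n S ∈ Λ`, tends to
`1 / 2`. -/
theorem tendsto_card_div_card (Λ : Set (ℕ × ℕ)) (α k : ℕ → ℤ)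
    (hΛ : ∃ s d : ℕ, (s, d) ∈ Λ ∧ Even d) (hα0 : ∀ᶠ n in atTop, 0 < α n)
    (hα : Tendsto α atTop atTop) (hk : ∀ᶠ n : ℕ in atTop, α n < k n ∧ k n < (n : ℤ) - α n) :
    Tendsto (fun n : ℕ =>
      (((interval n).powerset.filter fun S => k n ∈ S ∧ missing n S ∈ Λ).card : ℝ) /
        ((interval n).powerset.filter fun S => missing n S ∈ Λ).card) atTop (𝓝 (1 / 2)) := by
  obtain ⟨s, d, hsd, d, rfl⟩ := hΛ
  rw [← two_mul] at hsd
  obtain ⟨c, hc, hN⟩ := exists_le_card_missing_eq s d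
  have hα' : Tendsto (fun n => (α n).toNat) atTop atTop := by
    rw [tendsto_atTop] at hα ⊢
    intro b
    filter_upwards [hα b] with n hn
    omega
  have hlim : Tendsto (fun n => 30 / c * (9 / 10 : ℝ) ^ (α n).toNat) atTop (𝓝 0) := by
    have := ((tendsto_pow_atTop_nhds_zero_of_lt_one (r := (9 / 10 : ℝ)) (by norm_num)
      (by norm_num)).comp hα').const_mul (30 / c)
    simpa using this
  rw [tendsto_iff_norm_sub_tendsto_zero]
  refine squeeze_zero' (Eventually.of_forall fun n => norm_nonneg _) ?_ hlim
  filter_upwards [hα0, hk, hN] with n h0 hk hN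
  have hX := abs_two_mul_card_sub_card_le (n := n) (a := (α n).toNat) (k := k n) Λ (by omega)
    (by omega)
  set X : ℝ := (((interval n).powerset.filter fun S => k n ∈ S ∧ missing n S ∈ Λ).card : ℝ)
  set N : ℝ := (((interval n).powerset.filter fun S => missing n S ∈ Λ).card : ℝ) with hNdef
  have hN' : c * 2 ^ (n + 1) ≤ N := by
    refine hN.trans ?_
    rw [hNdef]
    refine Nat.cast_le.2 (Finset.card_le_card fun S hS => ?_)
    rw [Finset.mem_filter] at hS ⊢
    exact ⟨hS.1, hS.2.symm ▸ hsd⟩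
  have hNpos : 0 < N := lt_of_lt_of_le (by positivity) hN'
  rw [Real.norm_eq_abs, show X / N - 1 / 2 = (2 * X - N) / (2 * N) by field_simp, abs_div,
    abs_of_pos (show 0 < 2 * N by positivity), div_le_iff₀ (by positivity)]
  refine hX.trans ?_
  calc 60 * (9 / 10 : ℝ) ^ (α n).toNat * 2 ^ (n + 1)
      = 30 / c * (9 / 10) ^ (α n).toNat * (2 * (c * 2 ^ (n + 1))) := by field_simp; ring
    _ ≤ 30 / c * (9 / 10) ^ (α n).toNat * (2 * N) := by gcongr

open Classical in
/-- Conditional probabilities of a uniform random subset are ratios of cardinalities. -/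
theorem uniformSubset_cond_real (n : ℕ) (P Q : Finset ℤ → Prop) :
    ((uniformSubset n)[|{S | P S}]).real {S | Q S} =
      (((interval n).powerset.filter fun S => Q S ∧ P S).card : ℝ) /
        ((interval n).powerset.filter P).card := by
  have : DiscreteMeasurableSpace (Finset ℤ) := ⟨fun _ => trivial⟩
  have h : ∀ R : Finset ℤ → Prop, (uniformSubset n).real {S | R S} =
      (((interval n).powerset.filter R).card : ℝ) / 2 ^ (n + 1) := by
    intro R
    have hR : ((interval n).powerset : Set (Finset ℤ)) ∩ {S | R S} =
        ((interval n).powerset.filter R : Finset (Finset ℤ)) := by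
      ext S; simp
    rw [measureReal_def, uniformSubset, uniformOn, cond_apply (Finset.measurableSet _), hR,
      Measure.count_apply_finset, Measure.count_apply_finset, Finset.card_powerset, card_interval]
    simp [div_eq_inv_mul]
  -- If no set satisfies P, both sides are 0, since the inverse of 0 becomes 0 in the reals.
  rw [measureReal_def, cond_apply (MeasurableSet.of_discrete), ENNReal.toReal_mul,
    ENNReal.toReal_inv, ← measureReal_def, ← measureReal_def, h P,
    show {S | P S} ∩ {S | Q S} = {S | Q S ∧ P S} by ext S; simp [and_comm], h]
  have : (2 : ℝ) ^ (n + 1) ≠ 0 := by positivity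
  field_simp
  congr!

/-- Bounding |S + S| by 2n + 1 is enough to control truncation: either inequality then forces |S -
S| < 2n + 1. -/
theorem isMSTD_iff_missing {n : ℕ} {S : Finset ℤ} (hS : S ⊆ interval n) :
    IsMSTD S ↔ (missing n S).1 < (missing n S).2 := by
  have hbd : ∀ x ∈ S, 0 ≤ x ∧ x ≤ n := fun x hx => mem_interval.1 (hS hx)
  have h1 : (S + S).card ≤ 2 * n + 1 := by
    have : S + S ⊆ Finset.Icc 0 (2 * n : ℤ) := by
      intro x hx
      obtain ⟨u, hu, v, hv, rfl⟩ := Finset.mem_add.1 hx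
      have := hbd u hu
      have := hbd v hv
      exact Finset.mem_Icc.2 (by omega)
    have := Finset.card_le_card this
    rw [Int.card_Icc] at this
    omega
  rw [IsMSTD, missing]
  dsimp only
  omega

theorem mainTheorem6 :
    (∀ (Λ : Set (ℕ × ℕ)) (α k : ℕ → ℤ),
      (∃ s d : ℕ, (s, d) ∈ Λ ∧ Even d) →
      (∀ᶠ n : ℕ in atTop, 0 < α n ∧ (α n : ℝ) < (n : ℝ) / 2) →
      Tendsto α atTop atTop →
      (∀ᶠ n : ℕ in atTop, α n < k n ∧ k n < (n : ℤ) - α n) →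
      Tendsto
        (fun n : ℕ => ((uniformSubset n)[|{S | missing n S ∈ Λ}]).real {S | k n ∈ S})
        atTop (𝓝 (1 / 2))) ∧
    (∀ (c : ℝ) (k : ℕ → ℤ),
      0 < c → c < 1 / 2 →
      (∀ᶠ n : ℕ in atTop, c * n < (k n : ℝ) ∧ (k n : ℝ) < n - c * n) →
      Tendsto (fun n : ℕ => mstdProportion n (k n)) atTop (𝓝 (1 / 2))) := by
  classical
  refine ⟨fun Λ α k hΛ hα0 hα hk => ?_, fun c k hc _ hk => ?_⟩
  · refine (tendsto_card_div_card Λ α k hΛ (hα0.mono fun n h => h.1) hα hk).congr fun n => ?_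
    rw [uniformSubset_cond_real]
    congr!
  · have hα : Tendsto (fun n : ℕ => ⌊c * n⌋) atTop atTop :=
      tendsto_floor_atTop.comp (tendsto_natCast_atTop_atTop.const_mul_atTop hc)
    have h := tendsto_card_div_card {p | p.1 < p.2} (fun n => ⌊c * n⌋) k
      ⟨0, 2, by simp, even_two⟩ (hα.eventually_gt_atTop 0) hα ?_
    · refine h.congr fun n => ?_
      rw [mstdProportion]
      have hiff : ∀ S ∈ (interval n).powerset,
          (missing n S ∈ {p : ℕ × ℕ | p.1 < p.2} ↔ IsMSTD S) := fun S hS =>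
        (isMSTD_iff_missing (Finset.mem_powerset.1 hS)).symm
      congr 3 <;> ext S <;> simp only [Finset.mem_filter] <;> have := hiff S <;> tauto
    · filter_upwards [hk] with n hn
      have hfl := Int.floor_le (c * n)
      constructor
      · exact_mod_cast hfl.trans_lt hn.1
      · have : (k n : ℝ) < n - ⌊c * n⌋ := by linarith
        exact_mod_cast this
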